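/- Let $\mathcal H$ be the complex upper half plane, with $g\tau=\frac{a\tau+b}{c\tau+d}$ for $g=\begin{pmatrix}a&b\\c&d\end{pmatrix}\in\operatorname{GL}_2^+(\mathbb Q)$ and $\tau\in\mathcal H$. For $k=4,6$ let $$E_k(\tau)=\frac12\sum_{\substack{(m,n)\in\mathbb Z^2\\ \gcd(m,n)=1}}\frac1{(m\tau+n)^k},$$ and let $E_2(\tau)=\frac{1}{2\zeta(2)}\sum_{m\in\mathbb Z}\sum_{n\in\mathbb Z,\,(m,n)\neq(0,0)}\frac{1}{(m\tau+n)^2}$, where the inner sum over $n$ is taken first and the outer sum is the limit of the sums over $|m|\le M$ as $M\to\infty$. Put $$E_2^*(\tau)=E_2(\tau)-\frac{3}{\pi\operatorname{Im}\tau},\qquad \Delta=\frac{E_4^3-E_6^2}{1728},\qquad j=\frac{1728\,E_4^3}{E_4^3-E_6^2},\qquad \chi^*=\frac{E_2^*E_4E_6}{\Delta}.$$ (The function $\Delta$ has no zero on $\mathcal H$.) For a positive integer $N$, let $M_N$ be the set of matrices in $\operatorname{GL}_2^+(\mathbb Q)$ with integer entries and determinant $N$ that are primitive, i.e. the four entries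 have greatest common divisor $1$. **Proposition.** For every positive integer $N$ there is a nonzero polynomial $\Psi_N\in\mathbb Q[X,Y,Z]$, irreducible in $\mathbb C[X,Y,Z]$, such that $$\Psi_N(\chi^*(g\tau),j(\tau),\chi^*(\tau))=0$$ for all $g\in M_N$ and all $\tau\in\mathcal H$. -/

import Mathlib

open UpperHalfPlane ModularForm EisensteinSeries
open scoped MatrixGroups

noncomputable section

namespace ModRel

/-- The discriminant function `Δ = (E₄³ - E₆²) / 1728` on the upper half plane. -/
def Delta (τ : ℍ) : ℂ := (E₄ τ ^ 3 - E₆ τ ^ 2) / 1728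

/-- Sanity check: `Δ` has no zero on the upper half plane, so that the quotients below are
genuine quotients. -/
theorem Delta_ne_zero (τ : ℍ) : Delta τ ≠ 0 := by
  have h := discriminant_ne_zero τ
  rw [discriminant_eq_E₄_cube_sub_E₆_sq] at h
  exact h

/-- The modular function `j = 1728 E₄³ / (E₄³ - E₆²)`. -/
def j (τ : ℍ) : ℂ := 1728 * (E₄ τ ^ 3 / (E₄ τ ^ 3 - E₆ τ ^ 2))

/-- The almost holomorphic Eisenstein series `E₂*(τ) = E₂(τ) - 3 / (π Im τ)` of weight 2. -/
def E2star (τ : ℍ) : ℂ := E2 τ - 3 / ((Real.pi : ℂ) * (τ.im : ℂ))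

/-- The almost holomorphic modular function `χ* = E₂* E₄ E₆ / Δ`. -/
def chiStar (τ : ℍ) : ℂ := E2star τ * (E₄ τ * E₆ τ / Delta τ)

/-- The set `M_N` of `g ∈ GL₂⁺(ℚ)` with integer entries and determinant `N` that are primitive:
only units of `ℤ` divide all four entries. -/
def primitiveMatrices (N : ℕ) : Set (GL(2, ℚ)⁺) :=
  {g | ∃ A : Matrix (Fin 2) (Fin 2) ℤ,
      (∀ i k, (g : GL (Fin 2) ℚ) i k = (A i k : ℚ)) ∧
      A.det = (N : ℤ) ∧
      ∀ d : ℤ, (∀ i k, d ∣ A i k) → IsUnit d}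

/-- The Möbius action of `GL₂⁺(ℚ)` on the upper half plane, through `GL₂(ℝ)`. -/
def moebius (g : GL(2, ℚ)⁺) (τ : ℍ) : ℍ :=
  ((g : GL (Fin 2) ℚ).map (algebraMap ℚ ℝ)) • τ

/-- Sanity check: `g τ = (a τ + b) / (c τ + d)`. -/
theorem coe_moebius (g : GL(2, ℚ)⁺) (τ : ℍ) :
    ((moebius g τ : ℍ) : ℂ) =
      (((g : GL (Fin 2) ℚ) 0 0 : ℂ) * τ + ((g : GL (Fin 2) ℚ) 0 1 : ℂ)) /
        (((g : GL (Fin 2) ℚ) 1 0 : ℂ) * τ + ((g : GL (Fin 2) ℚ) 1 1 : ℂ)) := by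
  have hq : 0 < ((g : GL (Fin 2) ℚ).det : ℚ) := g.2
  have hdet : 0 < (((g : GL (Fin 2) ℚ).map (algebraMap ℚ ℝ)).det : ℝ) := by
    rw [Matrix.GeneralLinearGroup.map_det]
    simpa using hq
  rw [moebius, coe_smul_of_det_pos hdet]
  simp [num, denom]

end ModRel

end

/-! ### Transformation laws and holomorphy. -/

noncomputable section

open Complex Filter Asymptotics
open scoped Manifold Topology

namespace ModRel

/-! Replace `3 / (π Im τ)` by a free parameter `s`. With `q = E₄E₆/Δ` of weight `-2`, put `χ(τ, s) =
(E₂(τ) - s) q(τ)`. Multiplying by `j(j - 1728) = q · quotTwo` gives `N j(j - 1728) χ(Nτ, s/N) = j(j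
- 1728) U + V χ(τ, s)`, where `U = isogenyU` and `V = isogenyV` are holomorphic, `Γ₀(N)`-invariant
and polynomially bounded in `|j|`. That bound is `SL(2, ℤ)`-invariant, so it controls all cusps at
once. The coefficients of the product of `X - φ` over the translates `φ` of such a function are
polynomials in `j` (`isIntegralElem_evalJ`). Hence the left side is integral over `ℂ[j, χ]`, and a
nonzero relation exists (`exists_isRelation`).

Relations form a prime ideal (`IsRelation.of_mul`): holomorphic functions on `ℍ` form a domain, and
dependence on `s` is polynomial. So a nonzero relation of least total degree is irreducible. For
rational `s` all the `q`-series are rational, so a `ℚ`-linear functional applied to the coefficients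
gives a rational relation of no larger degree (`isRelation_mapCoeffs`), still minimal and so
irreducible over `ℂ`. Finally `M_N` is contained in `SL(2, ℤ) diag(N, 1) SL(2, ℤ)`
(`exists_moebius_eq`), and `χ*`, `j` are `SL(2, ℤ)`-invariant. -/

/-- Multiplication of a point of the upper half plane by a positive integer. -/
def scale (N : ℕ) [NeZero N] (τ : ℍ) : ℍ :=
  ⟨(N : ℂ) * τ, by
    have : (0 : ℝ) < N := Nat.cast_pos.mpr (NeZero.pos N)
    simpa using mul_pos this τ.im_pos⟩

lemma coe_scale (N : ℕ) [NeZero N] (τ : ℍ) : (scale N τ : ℂ) = N * τ := rfl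

lemma im_scale (N : ℕ) [NeZero N] (τ : ℍ) : (scale N τ).im = N * τ.im := by
  simp [scale, ← coe_im]

/-- Every integer solution of `ad - bc = 1` is given by a matrix in `SL(2, ℤ)`. -/
lemma exists_SL_of_det {a b c d : ℤ} (h : a * d - b * c = 1) :
    ∃ γ : SL(2, ℤ), ∀ τ : ℍ, ((γ • τ : ℍ) : ℂ) = (a * τ + b) / (c * τ + d) ∧
      denom γ τ = c * τ + d := by
  let γ : SL(2, ℤ) := ⟨!![a, b; c, d], by rw [Matrix.det_fin_two_of]; exact h⟩
  have h00 : γ 0 0 = a := rfl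
  have h01 : γ 0 1 = b := rfl
  have h10 : γ 1 0 = c := rfl
  have h11 : γ 1 1 = d := rfl
  refine ⟨γ, fun τ ↦ ⟨?_, ?_⟩⟩
  · rw [coe_specialLinearGroup_apply, h00, h01, h10, h11]
    simp
  · rw [ModularGroup.denom_apply, h10, h11]

lemma E₄_smul (γ : SL(2, ℤ)) (τ : ℍ) : E₄ (γ • τ) = denom γ τ ^ 4 * E₄ τ := by
  exact_mod_cast SlashInvariantForm.slash_action_eqn'' E₄ (Γ := 𝒮ℒ) (γ := γ) ⟨γ, rfl⟩ τ

lemma E₆_smul (γ : SL(2, ℤ)) (τ : ℍ) : E₆ (γ • τ) = denom γ τ ^ 6 * E₆ τ := by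
  exact_mod_cast SlashInvariantForm.slash_action_eqn'' E₆ (Γ := 𝒮ℒ) (γ := γ) ⟨γ, rfl⟩ τ

lemma Delta_smul (γ : SL(2, ℤ)) (τ : ℍ) : Delta (γ • τ) = denom γ τ ^ 12 * Delta τ := by
  simp only [Delta, E₄_smul, E₆_smul]; ring

lemma Delta_eq_discriminant : Delta = discriminant := by
  ext τ; rw [discriminant_eq_E₄_cube_sub_E₆_sq, Delta]

lemma j_eq (τ : ℍ) : j τ = E₄ τ ^ 3 / Delta τ := by
  have := Delta_ne_zero τ
  rw [Delta] at *
  rw [j]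
  have h : E₄ τ ^ 3 - E₆ τ ^ 2 ≠ 0 := fun h ↦ this (by simp [h])
  field_simp

lemma j_sub_eq (τ : ℍ) : j τ - 1728 = E₆ τ ^ 2 / Delta τ := by
  rw [j_eq, eq_div_iff (Delta_ne_zero τ), sub_mul, div_mul_cancel₀ _ (Delta_ne_zero τ), Delta]
  ring

lemma j_smul (γ : SL(2, ℤ)) (τ : ℍ) : j (γ • τ) = j τ := by
  have := denom_ne_zero γ τ
  have := Delta_ne_zero τ
  simp only [j_eq, E₄_smul, Delta_smul]
  field_simp

lemma E2_smul (γ : SL(2, ℤ)) (τ : ℍ) :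
    E2 (γ • τ) = denom γ τ ^ 2 * E2 τ + 6 * γ 1 0 * denom γ τ / (Real.pi * Complex.I) := by
  have h := congrFun (E2_slash_action γ) τ
  have hd := denom_ne_zero γ τ
  have hπ : (Real.pi : ℂ) ≠ 0 := by simp
  rw [SL_slash_apply] at h
  simp only [Pi.sub_apply, Pi.smul_apply, smul_eq_mul, D2, riemannZeta_two] at h
  have h2 : denom γ τ ^ (-2 : ℤ) = (denom γ τ ^ 2)⁻¹ := by norm_cast
  rw [h2] at h
  rw [eq_sub_iff_add_eq] at h
  rw [← h]
  field_simp
  ring_nf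
  simp

/-- The anomaly `6c(cτ + d)/(πi)` of `E2` cancels against that of `1 / Im τ`. -/
lemma E2star_smul (γ : SL(2, ℤ)) (τ : ℍ) :
    E2star (γ • τ) = denom γ τ ^ 2 * E2star τ := by
  have hd := denom_ne_zero γ τ
  have hπ : (Real.pi : ℂ) ≠ 0 := by simp
  have hy : (τ.im : ℂ) ≠ 0 := by simpa using τ.im_ne_zero
  -- The second factor is the conjugate of `cτ + d`.
  have hs : ((normSq (denom γ τ) : ℝ) : ℂ) = denom γ τ * (denom γ τ - 2 * Complex.I * γ 1 0 * τ.im) := by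
    rw [← mul_conj]
    congr 1
    apply Complex.ext <;> simp [ModularGroup.denom_apply]
    ring
  have hs0 : ((normSq (denom γ τ) : ℝ) : ℂ) ≠ 0 := by simp
  rw [E2star, E2star, E2_smul, ModularGroup.im_smul_eq_div_normSq]
  push_cast
  rw [div_eq_mul_inv 3 (_ * (_ / _)), mul_inv, inv_div, hs]
  field_simp
  ring_nf
  simp

/-- The weight `-2` quotient `E₄E₆ / Δ`. -/
def quotNegTwo (τ : ℍ) : ℂ := E₄ τ * E₆ τ / Delta τ

/-- The weight `2` quotient `E₄²E₆ / Δ`. -/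
def quotTwo (τ : ℍ) : ℂ := E₄ τ ^ 2 * E₆ τ / Delta τ

lemma quotNegTwo_smul (γ : SL(2, ℤ)) (τ : ℍ) :
    quotNegTwo (γ • τ) = (denom γ τ ^ 2)⁻¹ * quotNegTwo τ := by
  have := denom_ne_zero γ τ
  have := Delta_ne_zero τ
  simp only [quotNegTwo, E₄_smul, E₆_smul, Delta_smul]
  field_simp

lemma quotTwo_smul (γ : SL(2, ℤ)) (τ : ℍ) :
    quotTwo (γ • τ) = denom γ τ ^ 2 * quotTwo τ := by
  have := denom_ne_zero γ τ
  have := Delta_ne_zero τ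
  simp only [quotTwo, E₄_smul, E₆_smul, Delta_smul]
  field_simp

/-- `quotTwo` serves as an inverse of `quotNegTwo` up to a polynomial in `j`, without introducing
poles in `ℍ`. -/
lemma quotNegTwo_mul_quotTwo (τ : ℍ) : quotNegTwo τ * quotTwo τ = j τ * (j τ - 1728) := by
  have := Delta_ne_zero τ
  rw [j_sub_eq, j_eq, quotNegTwo, quotTwo]
  field_simp

lemma chiStar_eq (τ : ℍ) : chiStar τ = E2star τ * quotNegTwo τ := rfl

lemma chiStar_smul (γ : SL(2, ℤ)) (τ : ℍ) : chiStar (γ • τ) = chiStar τ := by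
  have := denom_ne_zero γ τ
  simp only [chiStar_eq, E2star_smul, quotNegTwo_smul]
  field_simp

lemma mdiff_E₄ : MDiff (fun τ : ℍ ↦ E₄ τ) := E₄.holo'

lemma mdiff_E₆ : MDiff (fun τ : ℍ ↦ E₆ τ) := E₆.holo'

lemma mdiff_Delta : MDiff Delta := by
  rw [Delta_eq_discriminant]; exact CuspForm.discriminant.holo'

lemma mdiff_quotNegTwo : MDiff quotNegTwo :=
  (mdiff_E₄.mul mdiff_E₆).div mdiff_Delta Delta_ne_zero

lemma mdiff_quotTwo : MDiff quotTwo :=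
  ((mdiff_E₄.pow 2).mul mdiff_E₆).div mdiff_Delta Delta_ne_zero

lemma mdiff_j : MDiff j := by
  rw [show j = fun τ ↦ E₄ τ ^ 3 / Delta τ from funext j_eq]
  exact (mdiff_E₄.pow 3).div mdiff_Delta Delta_ne_zero

lemma mdiff_comp_scale (N : ℕ) [NeZero N] {f : ℍ → ℂ} (hf : MDiff f) :
    MDiff (fun τ ↦ f (scale N τ)) := by
  rw [UpperHalfPlane.mdifferentiable_iff] at *
  have hN : (0 : ℝ) < N := Nat.cast_pos.mpr (NeZero.pos N)
  have hmaps : Set.MapsTo (fun z : ℂ ↦ (N : ℂ) * z) {z | 0 < z.im} {z | 0 < z.im} := by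
    intro z hz
    simpa using mul_pos hN hz
  refine (hf.comp (by fun_prop) hmaps).congr fun z hz ↦ ?_
  have : scale N (ofComplex z) = ofComplex ((N : ℂ) * z) := by
    apply UpperHalfPlane.ext
    rw [coe_scale, ofComplex_apply_of_im_pos hz, ofComplex_apply_of_im_pos (hmaps hz)]
  simp [this]

lemma mdiff_comp_smul (γ : SL(2, ℤ)) {f : ℍ → ℂ} (hf : MDiff f) :
    MDiff (fun τ ↦ f (γ • τ)) :=
  hf.comp (mdifferentiable_smul (g := (γ : GL (Fin 2) ℝ)) (by simp))

end ModRel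

end

/-! ### Growth bounds in terms of `|j|`. -/

noncomputable section

open Complex Filter Asymptotics
open scoped Manifold Topology

namespace ModRel

/-- With `e = gcd(cN, d) ≥ 1`, the denominator `cNτ + d` is `e(c'τ + d')` for a coprime pair `(c',
d')`, the bottom row of `γ'`. -/
lemma exists_im_smul_scale_le (N : ℕ) [NeZero N] (γ : SL(2, ℤ)) (τ : ℍ) :
    ∃ γ' : SL(2, ℤ), (γ • scale N τ).im ≤ N * (γ' • τ).im := by
  have hN : (N : ℤ) ≠ 0 := by exact_mod_cast NeZero.ne N
  have hcop : IsCoprime (γ 1 0) (γ 1 1) := ModularGroup.bottom_row_coprime γ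
  have hpos : 0 < Int.gcd (γ 1 0 * N) (γ 1 1) := by
    rw [Nat.pos_iff_ne_zero]
    intro h
    rw [Int.gcd_eq_zero_iff] at h
    have h0 : γ 1 0 = 0 := (mul_eq_zero.mp h.1).resolve_right hN
    rw [h0, h.2] at hcop
    exact not_isCoprime_zero_zero hcop
  set e := Int.gcd (γ 1 0 * N) (γ 1 1) with he
  obtain ⟨c', d', hcd, hc, hd⟩ := Int.exists_gcd_one hpos
  obtain ⟨γ', -, hγ'⟩ := ModularGroup.bottom_row_surj (R := ℤ)
    (show IsCoprime (![c', d'] 0) (![c', d'] 1) from Int.isCoprime_iff_gcd_eq_one.mpr hcd)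
  have hγ0 : γ' 1 0 = c' := congrFun hγ' 0
  have hγ1 : γ' 1 1 = d' := congrFun hγ' 1
  refine ⟨γ', ?_⟩
  have hden : denom γ (scale N τ) = e * denom γ' τ := by
    rw [ModularGroup.denom_apply, ModularGroup.denom_apply, coe_scale, hγ0, hγ1]
    have h1 : (γ 1 0 : ℂ) * N = c' * e := by exact_mod_cast hc
    have h2 : (γ 1 1 : ℂ) = d' * e := by exact_mod_cast hd
    rw [← mul_assoc, h1, h2]; ring
  have hpos' : 0 < normSq (denom γ' τ) := normSq_denom_pos _ τ.im_ne_zero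
  rw [ModularGroup.im_smul_eq_div_normSq, ModularGroup.im_smul_eq_div_normSq, hden, im_scale,
    ← mul_div_assoc, normSq_mul]
  have he1 : (1 : ℝ) ≤ normSq (e : ℂ) := by
    rw [normSq_natCast]
    exact_mod_cast Nat.mul_pos hpos hpos
  have := τ.im_pos
  gcongr
  nlinarith

lemma tendsto_E₄_atImInfty : Tendsto (fun τ : ℍ ↦ E₄ τ) atImInfty (𝓝 1) := by
  have hper := SlashInvariantFormClass.periodic_comp_ofComplex E₄ one_mem_strictPeriods_SL
  have han := ModularFormClass.analyticAt_cuspFunction_zero E₄ one_pos one_mem_strictPeriods_SL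
  have h1 : valueAtInfty E₄ = 1 := by
    rw [← UpperHalfPlane.qExpansion_coeff_zero one_pos han hper,
      E_qExpansion_coeff_zero _ ⟨2, rfl⟩]
  have h2 := exp_decay_sub_atImInfty one_pos hper E₄.holo' (ModularFormClass.bdd_at_infty E₄)
  rw [h1] at h2
  have h3 : Tendsto (fun τ : ℍ ↦ Real.exp (-2 * Real.pi * τ.im / 1)) atImInfty (𝓝 0) := by
    refine Real.tendsto_exp_atBot.comp ?_
    have : Tendsto (fun τ : ℍ ↦ (2 * Real.pi) * τ.im) atImInfty atTop :=
      Tendsto.const_mul_atTop (by positivity) tendsto_comap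
    refine (tendsto_neg_atTop_atBot.comp this).congr fun τ ↦ by simp
  have := h2.trans_tendsto h3
  simpa using! this.add_const 1

lemma inv_Delta_isBigO :
    (fun τ ↦ (Delta τ)⁻¹) =O[atImInfty] fun τ ↦ Real.exp (2 * Real.pi * τ.im) := by
  rw [Delta_eq_discriminant]
  refine (exp_isBigO_discriminant.inv_rev (by simp)).congr_right fun τ ↦ ?_
  rw [← Real.exp_neg]; congr 1; ring

/-- `Δ` decays at least like `exp(-2π Im τ)` and `E₄ → 1`, so `j = E₄³/Δ` grows at least like the
inverse. -/
lemma exp_isBigO_j : (fun τ : ℍ ↦ Real.exp (2 * Real.pi * τ.im)) =O[atImInfty] j := by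
  have hΔ : Delta =O[atImInfty] fun τ ↦ Real.exp (-2 * Real.pi * τ.im / 1) := by
    rw [Delta_eq_discriminant]
    exact CuspFormClass.exp_decay_atImInfty CuspForm.discriminant one_pos
      one_mem_strictPeriods_SL
  have h1 : (fun τ : ℍ ↦ Real.exp (2 * Real.pi * τ.im)) =O[atImInfty] fun τ ↦ (Delta τ)⁻¹ := by
    refine (hΔ.inv_rev (by simp [Delta_ne_zero])).congr_left fun τ ↦ ?_
    rw [← Real.exp_neg]; congr 1; ring
  have h2 : (fun _ : ℍ ↦ (1 : ℂ)) =O[atImInfty] fun τ ↦ E₄ τ ^ 3 := by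
    have := (tendsto_E₄_atImInfty.pow 3).inv₀ (by simp)
    have h3 := this.isBigO_one ℂ
    have hne : ∀ᶠ τ in atImInfty, E₄ τ ^ 3 ≠ 0 := by
      have := (tendsto_E₄_atImInfty.pow 3).eventually (eventually_ne_nhds (by simp : (1 : ℂ) ^ 3 ≠ 0))
      exact this
    have := h3.inv_rev (hne.mono fun τ h h' ↦ absurd (inv_eq_zero.mp h') h)
    simpa using this
  have h4 := h1.norm_right.mul h2.norm_left.norm_right
  rw [← isBigO_norm_right]
  refine (h4.congr_left fun τ ↦ by simp).congr_right fun τ ↦ ?_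
  rw [j_eq, norm_div, norm_inv, div_eq_inv_mul]

/-- The exponential of the height of a point is controlled by its `j`-invariant. -/
lemma exists_exp_le : ∃ C : ℝ, ∀ τ : ℍ,
    Real.exp (2 * Real.pi * τ.im) ≤ C * (1 + ‖j τ‖) := by
  obtain ⟨C, hC0, hC⟩ := exp_isBigO_j.exists_nonneg
  rw [IsBigOWith, Filter.Eventually, atImInfty_mem] at hC
  obtain ⟨A, hA⟩ := hC
  refine ⟨C + Real.exp (2 * Real.pi * A), fun τ ↦ ?_⟩
  have hj := norm_nonneg (j τ)
  have he := Real.exp_pos (2 * Real.pi * A)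
  rcases le_total A τ.im with h | h
  · have := hA τ h
    simp only [Set.mem_ofPred_eq, Real.norm_eq_abs, Real.abs_exp] at this
    nlinarith
  · have : Real.exp (2 * Real.pi * τ.im) ≤ Real.exp (2 * Real.pi * A) := by gcongr
    nlinarith

/-- Functions on the upper half plane bounded by a polynomial in `|j|`. -/
def JBounded (F : ℍ → ℂ) : Prop := ∃ C : ℝ, ∃ M : ℕ, ∀ τ, ‖F τ‖ ≤ C * (1 + ‖j τ‖) ^ M

/-- The quotient by the exponential is bounded on the fundamental domain. Only `‖F‖` need be
invariant, which admits forms of nonzero weight corrected by a power of `Im τ`. -/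
lemma exists_norm_le_exp {F : ℍ → ℂ} (hF : Continuous F)
    (hinv : ∀ (γ : SL(2, ℤ)) τ, ‖F (γ • τ)‖ = ‖F τ‖) {M : ℕ}
    (hO : F =O[atImInfty] fun τ ↦ Real.exp (2 * Real.pi * τ.im) ^ M) :
    ∃ C : ℝ, 0 ≤ C ∧ ∀ τ, ∃ γ : SL(2, ℤ),
      ‖F τ‖ ≤ C * Real.exp (2 * Real.pi * (γ • τ).im) ^ M := by
  have hcont : Continuous fun τ : ℍ ↦ F τ / (Real.exp (2 * Real.pi * τ.im) ^ M : ℝ) := by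
    refine hF.div (continuous_ofReal.comp (((Real.continuous_exp.comp
      (continuous_const.mul UpperHalfPlane.continuous_im))).pow M)) fun τ ↦ ?_
    exact_mod_cast (pow_pos (Real.exp_pos _) M).ne'
  obtain ⟨C, hC⟩ := ModularGroup.exists_bound_fundamental_domain_of_isBigO (t := 0) hcont (by
    obtain ⟨C, hC⟩ := hO.bound
    refine .of_bound C (hC.mono fun τ h ↦ ?_)
    have hpos : 0 < Real.exp (2 * Real.pi * τ.im) ^ M := by positivity
    rw [norm_div, Real.rpow_zero, norm_one, mul_one, norm_real, div_le_iff₀ (norm_pos_iff.mpr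
      hpos.ne')]
    exact h)
  refine ⟨max C 0, le_max_right _ _, fun τ ↦ ?_⟩
  obtain ⟨γ, hγ⟩ := ModularGroup.exists_smul_mem_fd τ
  refine ⟨γ, ?_⟩
  have h := hC _ hγ
  have hpos : 0 < Real.exp (2 * Real.pi * (γ • τ).im) ^ M := by positivity
  rw [norm_div, hinv, Real.rpow_zero, mul_one, norm_real, Real.norm_of_nonneg hpos.le,
    div_le_iff₀ hpos] at h
  refine h.trans ?_
  gcongr
  exact le_max_left _ _

/-- The height of any translate of `Nτ` is at most `N` times that of a translate of `τ`, and `j`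
controls the latter. -/
lemma JBounded.of_isBigO_scale (N : ℕ) [NeZero N] {F : ℍ → ℂ} (hF : Continuous F)
    (hinv : ∀ (γ : SL(2, ℤ)) τ, ‖F (γ • τ)‖ = ‖F τ‖) {M : ℕ}
    (hO : F =O[atImInfty] fun τ ↦ Real.exp (2 * Real.pi * τ.im) ^ M) :
    JBounded fun τ ↦ F (scale N τ) := by
  obtain ⟨C, hC0, hC⟩ := exists_norm_le_exp hF hinv hO
  obtain ⟨D, hD⟩ := exists_exp_le
  refine ⟨C * D ^ (N * M), N * M, fun τ ↦ ?_⟩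
  obtain ⟨γ, hγ⟩ := hC (scale N τ)
  obtain ⟨γ', hγ'⟩ := exists_im_smul_scale_le N γ τ
  calc ‖F (scale N τ)‖ ≤ C * Real.exp (2 * Real.pi * (γ • scale N τ).im) ^ M := hγ
    _ ≤ C * Real.exp (2 * Real.pi * (N * (γ' • τ).im)) ^ M := by gcongr
    _ = C * Real.exp (2 * Real.pi * (γ' • τ).im) ^ (N * M) := by
      rw [pow_mul, ← Real.exp_nat_mul _ N]; ring_nf
    _ ≤ C * (D * (1 + ‖j (γ' • τ)‖)) ^ (N * M) := by gcongr; exact hD _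
    _ = C * D ^ (N * M) * (1 + ‖j τ‖) ^ (N * M) := by rw [j_smul, mul_pow, mul_assoc]

lemma JBounded.of_isBigO {F : ℍ → ℂ} (hF : Continuous F)
    (hinv : ∀ (γ : SL(2, ℤ)) τ, ‖F (γ • τ)‖ = ‖F τ‖) {M : ℕ}
    (hO : F =O[atImInfty] fun τ ↦ Real.exp (2 * Real.pi * τ.im) ^ M) : JBounded F := by
  have h := JBounded.of_isBigO_scale 1 hF hinv hO
  have h1 : ∀ τ, scale 1 τ = τ := fun τ ↦ UpperHalfPlane.ext (by simp [coe_scale])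
  simpa only [h1] using h

lemma JBounded.mono_exponent {F : ℍ → ℂ} (hF : JBounded F) :
    ∃ C : ℝ, 0 ≤ C ∧ ∃ M : ℕ, ∀ M' ≥ M, ∀ τ, ‖F τ‖ ≤ C * (1 + ‖j τ‖) ^ M' := by
  obtain ⟨C, M, h⟩ := hF
  refine ⟨max C 0, le_max_right _ _, M, fun M' hM τ ↦ (h τ).trans ?_⟩
  have h1 : 1 ≤ 1 + ‖j τ‖ := by simp
  calc C * (1 + ‖j τ‖) ^ M ≤ max C 0 * (1 + ‖j τ‖) ^ M := by gcongr; exact le_max_left _ _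
    _ ≤ _ := by gcongr

lemma JBounded.const (c : ℂ) : JBounded fun _ ↦ c := ⟨‖c‖, 0, fun τ ↦ by simp⟩

lemma JBounded.add {F G : ℍ → ℂ} (hF : JBounded F) (hG : JBounded G) :
    JBounded fun τ ↦ F τ + G τ := by
  obtain ⟨C, -, M, hC⟩ := hF.mono_exponent
  obtain ⟨D, -, M', hD⟩ := hG.mono_exponent
  refine ⟨C + D, max M M', fun τ ↦ (norm_add_le _ _).trans ?_⟩
  rw [add_mul]
  exact add_le_add (hC _ (le_max_left _ _) τ) (hD _ (le_max_right _ _) τ)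

lemma JBounded.mul {F G : ℍ → ℂ} (hF : JBounded F) (hG : JBounded G) :
    JBounded fun τ ↦ F τ * G τ := by
  obtain ⟨C, hC0, M, hC⟩ := hF.mono_exponent
  obtain ⟨D, -, M', hD⟩ := hG.mono_exponent
  refine ⟨C * D, M + M', fun τ ↦ ?_⟩
  calc ‖F τ * G τ‖ = ‖F τ‖ * ‖G τ‖ := norm_mul _ _
    _ ≤ (C * (1 + ‖j τ‖) ^ M) * (D * (1 + ‖j τ‖) ^ M') :=
      mul_le_mul (hC _ le_rfl τ) (hD _ le_rfl τ) (norm_nonneg _) (by positivity)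
    _ = _ := by ring

lemma E₄_isBigO_one : (fun τ ↦ E₄ τ) =O[atImInfty] (1 : ℍ → ℝ) := ModularFormClass.bdd_at_infty E₄

lemma E₆_isBigO_one : (fun τ ↦ E₆ τ) =O[atImInfty] (1 : ℍ → ℝ) := ModularFormClass.bdd_at_infty E₆

lemma im_isBigO_exp :
    (fun τ : ℍ ↦ (τ.im : ℂ)) =O[atImInfty] fun τ ↦ Real.exp (2 * Real.pi * τ.im) := by
  refine .of_bound 1 (.of_forall fun τ ↦ ?_)
  have h1 := Real.add_one_le_exp (2 * Real.pi * τ.im)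
  have h2 := Real.pi_gt_three
  have := τ.im_pos
  simp only [norm_real, Real.norm_eq_abs, abs_of_pos τ.im_pos, Real.abs_exp, one_mul]
  nlinarith

lemma inv_im_isBigO_one : (fun τ : ℍ ↦ ((τ.im : ℂ))⁻¹) =O[atImInfty] (1 : ℍ → ℝ) := by
  rw [isBigO_iff]
  refine ⟨1, (atImInfty_mem _).mpr ⟨1, fun τ hτ ↦ ?_⟩⟩
  simpa [abs_of_pos τ.im_pos] using inv_le_one_of_one_le₀ hτ

lemma E2star_isBigO_one : E2star =O[atImInfty] (1 : ℍ → ℝ) := by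
  have : (fun τ : ℍ ↦ 3 / ((Real.pi : ℂ) * (τ.im : ℂ))) =O[atImInfty] (1 : ℍ → ℝ) := by
    refine (inv_im_isBigO_one.const_mul_left (3 / (Real.pi : ℂ))).congr_left fun τ ↦ ?_
    field_simp
  exact IsBigO.sub isBoundedAtImInfty_E2 this

lemma quotNegTwo_isBigO : quotNegTwo =O[atImInfty] fun τ ↦ Real.exp (2 * Real.pi * τ.im) := by
  have := (E₄_isBigO_one.mul E₆_isBigO_one).mul inv_Delta_isBigO
  simpa [quotNegTwo, ← div_eq_mul_inv] using! this

lemma quotTwo_isBigO : quotTwo =O[atImInfty] fun τ ↦ Real.exp (2 * Real.pi * τ.im) := by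
  have := ((E₄_isBigO_one.pow 2).mul E₆_isBigO_one).mul inv_Delta_isBigO
  simpa [quotTwo, ← div_eq_mul_inv] using! this

lemma continuous_E2star : Continuous E2star := by
  have h1 : Continuous E2 := E2_mdifferentiable.continuous
  refine h1.sub (continuous_const.div (continuous_const.mul
    (continuous_ofReal.comp UpperHalfPlane.continuous_im)) fun τ ↦ ?_)
  simp [τ.im_ne_zero]

lemma im_smul_eq (γ : SL(2, ℤ)) (τ : ℍ) : (γ • τ).im = τ.im / ‖denom γ τ‖ ^ 2 := by
  rw [ModularGroup.im_smul_eq_div_normSq, normSq_eq_norm_sq]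

lemma jBounded_chiStar_scale (N : ℕ) [NeZero N] : JBounded fun τ ↦ chiStar (scale N τ) := by
  refine JBounded.of_isBigO_scale N (M := 1)
    (continuous_E2star.mul mdiff_quotNegTwo.continuous) (fun γ τ ↦ by rw [chiStar_smul]) ?_
  simpa using! E2star_isBigO_one.mul quotNegTwo_isBigO

/-- In this and the next two lemmas, a factor `Im` or `1 / Im` makes the modulus of a form of weight
`2` or `-2` invariant. -/
lemma jBounded_E2star_mul_im : JBounded fun τ ↦ E2star τ * τ.im := by
  refine JBounded.of_isBigO (M := 1)
    (continuous_E2star.mul (continuous_ofReal.comp UpperHalfPlane.continuous_im)) (fun γ τ ↦ ?_) ?_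
  · have := denom_ne_zero γ τ
    simp only [E2star_smul, im_smul_eq, norm_mul, norm_pow, norm_real, norm_div, norm_norm]
    field_simp
  · simpa using! E2star_isBigO_one.mul im_isBigO_exp

lemma jBounded_quotNegTwo_scale_div (N : ℕ) [NeZero N] :
    JBounded fun τ ↦ quotNegTwo (scale N τ) / (scale N τ).im := by
  refine JBounded.of_isBigO_scale N (F := fun τ ↦ quotNegTwo τ / τ.im) (M := 1)
    (mdiff_quotNegTwo.continuous.div (continuous_ofReal.comp UpperHalfPlane.continuous_im)
      fun τ ↦ by simp [τ.im_ne_zero]) (fun γ τ ↦ ?_) ?_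
  · have := denom_ne_zero γ τ
    simp only [quotNegTwo_smul, im_smul_eq, norm_mul, norm_pow, norm_real, norm_div, norm_norm,
      norm_inv]
    field_simp
  · simpa [div_eq_mul_inv] using! quotNegTwo_isBigO.mul inv_im_isBigO_one

lemma jBounded_quotTwo_mul_im : JBounded fun τ ↦ quotTwo τ * τ.im := by
  refine JBounded.of_isBigO (M := 2)
    (mdiff_quotTwo.continuous.mul (continuous_ofReal.comp UpperHalfPlane.continuous_im)) (fun γ τ ↦ ?_) ?_
  · have := denom_ne_zero γ τ
    simp only [quotTwo_smul, im_smul_eq, norm_mul, norm_pow, norm_real, norm_div, norm_norm]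
    field_simp
  · simpa [pow_two] using! quotTwo_isBigO.mul im_isBigO_exp

/-! ### The functions `isogenyU` and `isogenyV` of level `Γ₀(N)`. -/

/-- The `Γ₀(N)`-invariant function `(N E₂(Nτ) - E₂(τ)) (E₄E₆/Δ)(Nτ)`. -/
def isogenyU (N : ℕ) [NeZero N] (τ : ℍ) : ℂ :=
  (N * E2 (scale N τ) - E2 τ) * quotNegTwo (scale N τ)

/-- The `Γ₀(N)`-invariant function `(E₄E₆/Δ)(Nτ) (E₄²E₆/Δ)(τ)`. -/
def isogenyV (N : ℕ) [NeZero N] (τ : ℍ) : ℂ := quotNegTwo (scale N τ) * quotTwo τ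

/-- The nonholomorphic terms cancel because `Im(Nτ) = N Im τ`; this makes `isogenyU` both
holomorphic and modular. -/
lemma isogenyU_eq (N : ℕ) [NeZero N] (τ : ℍ) :
    isogenyU N τ = (N * E2star (scale N τ) - E2star τ) * quotNegTwo (scale N τ) := by
  have hN : (N : ℂ) ≠ 0 := by exact_mod_cast NeZero.ne N
  have hy : (τ.im : ℂ) ≠ 0 := by simp [τ.im_ne_zero]
  rw [isogenyU, E2star, E2star, im_scale]
  push_cast
  field_simp
  ring

lemma mdiff_isogenyU (N : ℕ) [NeZero N] : MDiff (isogenyU N) :=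
  ((mdifferentiable_const.mul (mdiff_comp_scale N E2_mdifferentiable)).sub
    E2_mdifferentiable).mul (mdiff_comp_scale N mdiff_quotNegTwo)

lemma mdiff_isogenyV (N : ℕ) [NeZero N] : MDiff (isogenyV N) :=
  (mdiff_comp_scale N mdiff_quotNegTwo).mul mdiff_quotTwo

lemma jBounded_isogenyU (N : ℕ) [NeZero N] : JBounded (isogenyU N) := by
  -- `U = N χ*(Nτ) - N (E₂*(τ) Im τ) (q(Nτ) / Im(Nτ))`, with `q = quotNegTwo`.
  have h := (((JBounded.const N).mul (jBounded_chiStar_scale N))).add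
    ((JBounded.const (-N)).mul
      (jBounded_E2star_mul_im.mul (jBounded_quotNegTwo_scale_div N)))
  convert h using 2 with τ
  have hN : (N : ℂ) ≠ 0 := by exact_mod_cast NeZero.ne N
  have hy : (τ.im : ℂ) ≠ 0 := by simp [τ.im_ne_zero]
  rw [isogenyU_eq, chiStar_eq, im_scale]
  push_cast
  field_simp
  ring

lemma jBounded_isogenyV (N : ℕ) [NeZero N] : JBounded (isogenyV N) := by
  have h := (JBounded.const N).mul
      ((jBounded_quotNegTwo_scale_div N).mul jBounded_quotTwo_mul_im)
  convert h using 2 with τ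
  have hN : (N : ℂ) ≠ 0 := by exact_mod_cast NeZero.ne N
  have hy : (τ.im : ℂ) ≠ 0 := by simp [τ.im_ne_zero]
  rw [isogenyV, im_scale]
  push_cast
  field_simp

/-- For `γ ∈ Γ₀(N)`, the conjugate `γ'` of `γ` with `N (γ τ) = γ' (N τ)`. -/
lemma exists_scale_smul (N : ℕ) [NeZero N] {γ : SL(2, ℤ)}
    (hγ : γ ∈ CongruenceSubgroup.Gamma0 N) : ∃ γ' : SL(2, ℤ), ∀ τ,
      scale N (γ • τ) = γ' • scale N τ ∧ denom γ' (scale N τ) = denom γ τ := by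
  rw [CongruenceSubgroup.Gamma0_mem, ZMod.intCast_zmod_eq_zero_iff_dvd] at hγ
  obtain ⟨c, hc⟩ := hγ
  have hdet := γ.det_coe
  rw [Matrix.det_fin_two] at hdet
  -- `γ' = (a, Nb; c/N, d)` is the conjugate of `γ` by `diag(N, 1)`.
  obtain ⟨γ', hγ'⟩ := exists_SL_of_det
    (show γ 0 0 * γ 1 1 - (N * γ 0 1) * c = 1 by linear_combination hdet + γ 0 1 * hc)
  refine ⟨γ', fun τ ↦ ?_⟩
  obtain ⟨h1, h2⟩ := hγ' (scale N τ)
  have hc' : (γ 1 0 : ℂ) = N * c := by exact_mod_cast hc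
  have hden : denom γ τ = c * scale N τ + γ 1 1 := by
    rw [ModularGroup.denom_apply, coe_scale, hc']; ring
  refine ⟨UpperHalfPlane.ext ?_, h2.trans hden.symm⟩
  rw [h1, ← hden, coe_scale, coe_scale, coe_specialLinearGroup_apply, ModularGroup.denom_apply]
  simp only [algebraMap_int_eq, eq_intCast, ofReal_intCast]
  push_cast
  ring

lemma isogenyU_smul (N : ℕ) [NeZero N] {γ : SL(2, ℤ)}
    (hγ : γ ∈ CongruenceSubgroup.Gamma0 N) (τ : ℍ) : isogenyU N (γ • τ) = isogenyU N τ := by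
  obtain ⟨γ', h⟩ := exists_scale_smul N hγ
  obtain ⟨h1, h2⟩ := h τ
  have := denom_ne_zero γ τ
  rw [isogenyU_eq, isogenyU_eq, h1, E2star_smul, E2star_smul, quotNegTwo_smul, h2]
  field_simp

lemma isogenyV_smul (N : ℕ) [NeZero N] {γ : SL(2, ℤ)}
    (hγ : γ ∈ CongruenceSubgroup.Gamma0 N) (τ : ℍ) : isogenyV N (γ • τ) = isogenyV N τ := by
  obtain ⟨γ', h⟩ := exists_scale_smul N hγ
  obtain ⟨h1, h2⟩ := h τ
  have := denom_ne_zero γ τ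
  rw [isogenyV, isogenyV, h1, quotTwo_smul, quotNegTwo_smul, h2]
  field_simp

end ModRel

end

/-! ### Polynomials in `j`, and integrality over `ℂ[j]`. -/

noncomputable section

open Complex Filter Asymptotics
open scoped Manifold Topology Polynomial

namespace ModRel

section Invariant

variable {f : ℍ → ℂ} (hf : MDiff f) (hinv : ∀ (γ : SL(2, ℤ)) τ, f (γ • τ) = f τ) {M : ℕ}

include hinv in
lemma mul_Delta_pow_slash (γ : SL(2, ℤ)) :
    (fun τ ↦ f τ * Delta τ ^ M) ∣[(12 * M : ℤ)] γ = fun τ ↦ f τ * Delta τ ^ M := by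
  ext τ
  have hd := denom_ne_zero γ τ
  rw [SL_slash_apply, hinv, Delta_smul, mul_pow, ← pow_mul,
    show (-(12 * M : ℤ)) = -((12 * M : ℕ) : ℤ) by push_cast; rfl, zpow_neg, zpow_natCast]
  field_simp

/-- An invariant holomorphic function times a power of `Δ`, as a modular form. -/
def toModularForm (hb : IsBoundedAtImInfty fun τ ↦ f τ * Delta τ ^ M) :
    ModularForm 𝒮ℒ (12 * M : ℤ) where
  toFun := fun τ ↦ f τ * Delta τ ^ M
  slash_action_eq' := fun _ ⟨γ, hγ⟩ ↦ hγ ▸ mul_Delta_pow_slash hinv γ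
  holo' := hf.mul (mdiff_Delta.pow M)
  bdd_at_cusps' {c} hc := by
    rw [Subgroup.IsArithmetic.isCusp_iff_isCusp_SL2Z] at hc
    rw [OnePoint.isBoundedAt_iff_forall_SL2Z hc]
    intro γ _
    rw [mul_Delta_pow_slash hinv γ]
    exact hb

/-- An invariant holomorphic function times a power of `Δ`, as a cusp form. -/
def toCuspForm (hz : IsZeroAtImInfty fun τ ↦ f τ * Delta τ ^ M) :
    CuspForm 𝒮ℒ (12 * M : ℤ) where
  toFun := fun τ ↦ f τ * Delta τ ^ M
  slash_action_eq' := fun _ ⟨γ, hγ⟩ ↦ hγ ▸ mul_Delta_pow_slash hinv γ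
  holo' := hf.mul (mdiff_Delta.pow M)
  zero_at_cusps' {c} hc := by
    rw [Subgroup.IsArithmetic.isCusp_iff_isCusp_SL2Z] at hc
    rw [OnePoint.isZeroAt_iff_forall_SL2Z hc]
    intro γ _
    rw [mul_Delta_pow_slash hinv γ]
    exact hz

include hf hinv in
lemma exists_tendsto_mul_Delta_pow (hb : IsBoundedAtImInfty fun τ ↦ f τ * Delta τ ^ M) :
    ∃ c, Tendsto (fun τ ↦ f τ * Delta τ ^ M) atImInfty (𝓝 c) := by
  have han := ModularFormClass.analyticAt_cuspFunction_zero (toModularForm hf hinv hb) one_pos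
    one_mem_strictPeriods_SL
  refine ⟨_, (han.continuousAt.tendsto.comp (qParam_tendsto_atImInfty one_pos)).congr fun τ ↦ ?_⟩
  exact SlashInvariantFormClass.eq_cuspFunction (toModularForm hf hinv hb) τ
    one_mem_strictPeriods_SL one_ne_zero

end Invariant

/-- A holomorphic `SL(2, ℤ)`-invariant function with at most a pole at the cusp is a polynomial
in `j`. -/
lemma exists_eval_j {M : ℕ} : ∀ {f : ℍ → ℂ}, MDiff f → (∀ (γ : SL(2, ℤ)) τ, f (γ • τ) = f τ) →
    IsBoundedAtImInfty (fun τ ↦ f τ * Delta τ ^ M) → ∃ p : ℂ[X], ∀ τ, f τ = p.eval (j τ) := by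
  induction M with
  | zero =>
    intro f hf hinv hb
    let F : ModularForm 𝒮ℒ 0 := mcast (by simp) (toModularForm hf hinv hb)
    obtain ⟨c, hc⟩ := ModularFormClass.levelOne_weight_zero_const F
    refine ⟨Polynomial.C c, fun τ ↦ ?_⟩
    have := congrFun hc τ
    change f τ * Delta τ ^ 0 = c at this
    simpa using this
  | succ M ih =>
    intro f hf hinv hb
    obtain ⟨c, hc⟩ := exists_tendsto_mul_Delta_pow hf hinv hb
    -- Since `jΔ = E₄³ → 1`, subtracting this makes `g Δ^(M+1)` a cusp form. Being `O(Δ)`, it can be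
    -- divided by `Δ`, which lowers the pole order by one.
    set g : ℍ → ℂ := fun τ ↦ f τ - c * j τ ^ (M + 1) with hg
    have hgm : MDiff g := hf.sub (mdifferentiable_const.mul (mdiff_j.pow _))
    have hginv : ∀ (γ : SL(2, ℤ)) τ, g (γ • τ) = g τ := fun γ τ ↦ by
      simp only [hg, hinv, j_smul]
    have hz : IsZeroAtImInfty fun τ ↦ g τ * Delta τ ^ (M + 1) := by
      have h := hc.sub ((tendsto_E₄_atImInfty.pow (3 * (M + 1))).const_mul c)
      simp only [one_pow, mul_one, sub_self] at h
      refine h.congr fun τ ↦ ?_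
      have := Delta_ne_zero τ
      have hj : j τ ^ (M + 1) * Delta τ ^ (M + 1) = E₄ τ ^ (3 * (M + 1)) := by
        rw [← mul_pow, j_eq, div_mul_cancel₀ _ this, ← pow_mul]
      rw [← hj]
      simp only [hg]
      ring
    have hO : (fun τ ↦ g τ * Delta τ ^ (M + 1)) =O[atImInfty] Delta := by
      rw [Delta_eq_discriminant]
      have := CuspForm.exp_decay_isBigO_discriminant (toCuspForm hgm hginv hz)
      rw [← Delta_eq_discriminant] at this ⊢
      exact this
    obtain ⟨p, hp⟩ := ih hgm hginv (by
      have := hO.mul (isBigO_refl (fun τ ↦ (Delta τ)⁻¹) atImInfty)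
      refine (this.congr_left (f₂ := fun τ ↦ g τ * Delta τ ^ M) fun τ ↦ ?_).trans ?_
      · have := Delta_ne_zero τ
        field_simp
        ring
      · exact .of_bound 1 (.of_forall fun τ ↦ by simp [Delta_ne_zero τ]))
    refine ⟨p + Polynomial.C c * Polynomial.X ^ (M + 1), fun τ ↦ ?_⟩
    simp [← hp τ, hg]

/-- Since `|j| |Δ| = |E₄|³`, the hypothesis gives `|f Δ^M| ≤ C (|Δ| + |E₄|³)^M`, bounded at the
cusp. -/
lemma exists_eval_j_of_jBounded {f : ℍ → ℂ} (hf : MDiff f)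
    (hinv : ∀ (γ : SL(2, ℤ)) τ, f (γ • τ) = f τ) (hb : JBounded f) :
    ∃ p : ℂ[X], ∀ τ, f τ = p.eval (j τ) := by
  obtain ⟨C, M, h⟩ := hb
  refine exists_eval_j (M := M) hf hinv ?_
  have hΔ : Delta =O[atImInfty] (1 : ℍ → ℝ) := by
    rw [Delta_eq_discriminant]; exact ModularFormClass.bdd_at_infty CuspForm.discriminant
  have hE : (fun τ ↦ ‖E₄ τ ^ 3‖) =O[atImInfty] (1 : ℍ → ℝ) := by
    refine (E₄_isBigO_one.pow 3).norm_left.congr_right fun τ ↦ by simp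
  have h1 := ((hΔ.norm_left.add hE).pow M).const_mul_left C
  simp only [Pi.one_apply, one_pow] at h1
  refine IsBigO.trans (.of_bound 1 (.of_forall fun τ ↦ ?_)) h1
  have hne : 0 < ‖Delta τ‖ := norm_pos_iff.mpr (Delta_ne_zero τ)
  have hj : ‖E₄ τ ^ 3‖ = ‖j τ‖ * ‖Delta τ‖ := by
    rw [j_eq, ← norm_mul, div_mul_cancel₀ _ (Delta_ne_zero τ)]
  rw [one_mul, norm_mul, norm_pow, hj, ← one_add_mul, mul_pow, ← mul_assoc]
  refine le_trans ?_ (le_abs_self _)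
  gcongr
  exact h τ

/-- The `ℂ`-algebra of holomorphic functions bounded by a polynomial in `|j|`. -/
def jAlgebra : Subalgebra ℂ (ℍ → ℂ) where
  carrier := {f | MDiff f ∧ JBounded f}
  mul_mem' hf hg := ⟨hf.1.mul hg.1, hf.2.mul hg.2⟩
  add_mem' hf hg := ⟨hf.1.add hg.1, hf.2.add hg.2⟩
  algebraMap_mem' c := ⟨mdifferentiable_const, JBounded.const c⟩

/-- Translation of functions on the upper half plane by an element of `SL(2, ℤ)`. -/
def translateHom (γ : SL(2, ℤ)) : (ℍ → ℂ) →+* (ℍ → ℂ) :=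
  RingHom.pi fun τ ↦ Pi.evalRingHom (fun _ ↦ ℂ) (γ • τ)

lemma translateHom_apply (γ : SL(2, ℤ)) (f : ℍ → ℂ) (τ : ℍ) :
    translateHom γ f τ = f (γ • τ) := rfl

lemma translateHom_mem (γ : SL(2, ℤ)) {f : ℍ → ℂ} (hf : f ∈ jAlgebra) :
    translateHom γ f ∈ jAlgebra := by
  refine ⟨mdiff_comp_smul γ hf.1, ?_⟩
  obtain ⟨C, M, h⟩ := hf.2
  refine ⟨C, M, fun τ ↦ ?_⟩
  rw [translateHom_apply, ← j_smul γ]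
  exact h (γ • τ)

/-- Evaluation of polynomials at `j`. -/
def evalJ : ℂ[X] →+* (ℍ → ℂ) := (Polynomial.aeval (R := ℂ) j).toRingHom

lemma evalJ_apply (p : ℂ[X]) (τ : ℍ) : evalJ p τ = p.eval (j τ) := by
  rw [← Polynomial.coe_evalRingHom]
  have : (Pi.evalRingHom (fun _ ↦ ℂ) τ).comp evalJ = Polynomial.evalRingHom (j τ) := by
    ext
    · simp [evalJ]
    · simp [evalJ]
  exact RingHom.congr_fun this p

/-- A function in `jAlgebra` invariant under a subgroup of finite index is integral over
`ℂ[j]`. -/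
lemma isIntegralElem_evalJ (H : Subgroup SL(2, ℤ)) [H.FiniteIndex] {f : ℍ → ℂ}
    (hf : f ∈ jAlgebra) (hH : ∀ γ ∈ H, ∀ τ, f (γ • τ) = f τ) : evalJ.IsIntegralElem f := by
  classical
  have hfin : (Set.range fun γ ↦ translateHom γ f).Finite := by
    -- The translate by `γ` depends only on the right coset `Hγ`; the inverses pass to the left
    -- cosets of the quotient.
    have : Set.range (fun γ ↦ translateHom γ f) ⊆
        Set.range (fun x : SL(2, ℤ) ⧸ H ↦ translateHom x.out⁻¹ f) := by
      rintro _ ⟨γ, rfl⟩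
      refine ⟨QuotientGroup.mk γ⁻¹, ?_⟩
      obtain ⟨h, hh⟩ := QuotientGroup.mk_out_eq_mul H γ⁻¹
      ext τ
      simp only [translateHom_apply, hh, mul_inv_rev, inv_inv, mul_smul]
      exact hH _ (H.inv_mem h.2) _
    exact (Set.finite_range _).subset this
  set S := hfin.toFinset with hS
  have hmem : ∀ φ ∈ S, φ ∈ jAlgebra := by
    intro φ hφ
    obtain ⟨γ, rfl⟩ := hfin.mem_toFinset.mp hφ
    exact translateHom_mem γ hf
  set P : (ℍ → ℂ)[X] := ∏ φ ∈ S, (Polynomial.X - Polynomial.C φ) with hP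
  have hPA : P ∈ Polynomial.lifts jAlgebra.val.toRingHom := by
    refine Subsemiring.prod_mem _ fun φ hφ ↦ ?_
    exact ⟨Polynomial.X - Polynomial.C ⟨φ, hmem φ hφ⟩, by simp⟩
  have hcomp (γ δ : SL(2, ℤ)) (g : ℍ → ℂ) :
      translateHom γ (translateHom δ g) = translateHom (δ * γ) g := by
    ext τ; simp only [translateHom_apply, mul_smul]
  have hPinv (γ : SL(2, ℤ)) : P.map (translateHom γ) = P := by
    rw [hP, Polynomial.map_prod]
    simp only [Polynomial.map_sub, Polynomial.map_X, Polynomial.map_C]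
    refine Finset.prod_bij' (fun φ _ ↦ translateHom γ φ) (fun φ _ ↦ translateHom γ⁻¹ φ) ?_ ?_ ?_ ?_ ?_
    · intro φ hφ
      obtain ⟨δ, rfl⟩ := hfin.mem_toFinset.mp hφ
      exact hfin.mem_toFinset.mpr ⟨δ * γ, (hcomp _ _ _).symm⟩
    · intro φ hφ
      obtain ⟨δ, rfl⟩ := hfin.mem_toFinset.mp hφ
      exact hfin.mem_toFinset.mpr ⟨δ * γ⁻¹, (hcomp _ _ _).symm⟩
    · intro φ _; ext τ; simp only [translateHom_apply, smul_inv_smul]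
    · intro φ _; ext τ; simp only [translateHom_apply, inv_smul_smul]
    · intro φ _; rfl
  -- Translation permutes the factors of `P`, so each coefficient is invariant and hence a
  -- polynomial in `j`.
  have hPj : P ∈ Polynomial.lifts evalJ := by
    rw [Polynomial.lifts_iff_coeff_lifts] at hPA ⊢
    intro n
    obtain ⟨a, ha⟩ := hPA n
    have hco : P.coeff n ∈ jAlgebra := ha ▸ a.2
    obtain ⟨p, hp⟩ := exists_eval_j_of_jBounded hco.1 (fun γ τ ↦ by
      conv_rhs => rw [← hPinv γ, Polynomial.coeff_map]
      rfl) hco.2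
    exact ⟨p, funext fun τ ↦ by rw [hp, evalJ_apply]⟩
  have hmonic : P.Monic := Polynomial.monic_prod_of_monic _ _ fun φ _ ↦ Polynomial.monic_X_sub_C φ
  obtain ⟨p, hp, -, hpm⟩ := Polynomial.lifts_and_degree_eq_and_monic hPj hmonic
  refine ⟨p, hpm, ?_⟩
  rw [← Polynomial.eval_map, hp, hP, Polynomial.eval_prod]
  refine Finset.prod_eq_zero (i := f) (hfin.mem_toFinset.mpr ⟨1, ?_⟩) (by simp)
  ext τ; simp [translateHom_apply]

lemma isIntegralElem_isogenyU (N : ℕ) [NeZero N] : evalJ.IsIntegralElem (isogenyU N) :=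
  isIntegralElem_evalJ (CongruenceSubgroup.Gamma0 N) ⟨mdiff_isogenyU N, jBounded_isogenyU N⟩
    fun _ hγ ↦ isogenyU_smul N hγ

lemma isIntegralElem_isogenyV (N : ℕ) [NeZero N] : evalJ.IsIntegralElem (isogenyV N) :=
  isIntegralElem_evalJ (CongruenceSubgroup.Gamma0 N) ⟨mdiff_isogenyV N, jBounded_isogenyV N⟩
    fun _ hγ ↦ isogenyV_smul N hγ

end ModRel

end

/-! ### Relations with a free parameter `s`. -/

noncomputable section

open Complex Filter Asymptotics
open scoped Manifold Topology Polynomial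

namespace ModRel

/-- The function `((E₂ - s) E₄E₆/Δ)(τ)`, which specializes to `χ*` at `s = 3 / (π Im τ)`. -/
def chiParam (τ : ℍ) (s : ℂ) : ℂ := (E2 τ - s) * quotNegTwo τ

/-- The values at `(τ, s)` of the three functions whose relations are studied. -/
def relPoint (N : ℕ) [NeZero N] (τ : ℍ) (s : ℂ) : Fin 3 → ℂ :=
  ![chiParam (scale N τ) (s / N), j τ, chiParam τ s]

/-- Polynomials vanishing at all points `relPoint N τ s`. -/
def IsRelation (N : ℕ) [NeZero N] (P : MvPolynomial (Fin 3) ℂ) : Prop :=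
  ∀ τ s, MvPolynomial.eval (relPoint N τ s) P = 0

lemma chiParam_eq_chiStar (τ : ℍ) : chiParam τ (3 / (Real.pi * τ.im)) = chiStar τ := rfl

lemma relPoint_eq (N : ℕ) [NeZero N] (τ : ℍ) :
    relPoint N τ (3 / (Real.pi * τ.im)) = ![chiStar (scale N τ), j τ, chiStar τ] := by
  rw [relPoint, ← chiParam_eq_chiStar, ← chiParam_eq_chiStar, im_scale]
  congr 2
  push_cast
  rw [div_div, mul_comm (N : ℂ), mul_assoc]

/-- Evaluation of polynomials in two variables at `j` and `chiParam`. -/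
def evalJChi : MvPolynomial (Fin 2) ℂ →+* (ℍ × ℂ → ℂ) :=
  RingHom.pi fun x ↦ MvPolynomial.eval ![j x.1, chiParam x.1 x.2]

lemma evalJChi_apply (p : MvPolynomial (Fin 2) ℂ) (x : ℍ × ℂ) :
    evalJChi p x = MvPolynomial.eval ![j x.1, chiParam x.1 x.2] p := rfl

lemma isIntegralElem_evalJChi {f : ℍ → ℂ} (hf : evalJ.IsIntegralElem f) :
    evalJChi.IsIntegralElem fun x ↦ f x.1 := by
  let π : (ℍ → ℂ) →+* (ℍ × ℂ → ℂ) := RingHom.pi fun x ↦ Pi.evalRingHom (fun _ ↦ ℂ) x.1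
  let ι : ℂ[X] →+* MvPolynomial (Fin 2) ℂ := (Polynomial.aeval (MvPolynomial.X 0)).toRingHom
  have hπ : π.comp evalJ = evalJChi.comp ι := by
    ext a x
    · simp [π, ι, evalJChi_apply, evalJ_apply]
    · simp [π, ι, evalJChi_apply, evalJ_apply]
  obtain ⟨p, hp, h⟩ := hf
  refine ⟨p.map ι, hp.map ι, ?_⟩
  rw [Polynomial.eval₂_map, ← hπ]
  have := congrArg π h
  rwa [Polynomial.hom_eval₂, map_zero] at this

/-- There is a nontrivial algebraic relation. -/
lemma exists_isRelation (N : ℕ) [NeZero N] : ∃ P, P ≠ 0 ∧ IsRelation N P := by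
  have hN : (N : ℂ) ≠ 0 := by exact_mod_cast NeZero.ne N
  let b : MvPolynomial (Fin 2) ℂ := .X 0 * (.X 0 - .C 1728)
  let a : MvPolynomial (Fin 2) ℂ := .C (N : ℂ) * b
  have hb : b ≠ 0 := by
    intro h
    have := congrArg (MvPolynomial.eval ![1, 0]) h
    norm_num [b] at this
  have ha : a ≠ 0 := mul_ne_zero (by simpa using hN) hb
  -- The product equals `b U + χ V`, integral because `U` and `V` are.
  have hW : evalJChi.IsIntegralElem
      (fun x ↦ evalJChi a x * chiParam (scale N x.1) (x.2 / N)) := by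
    have h := ((evalJChi.isIntegralElem_map (x := b)).mul evalJChi
      (isIntegralElem_evalJChi (isIntegralElem_isogenyU N))).add evalJChi
      ((evalJChi.isIntegralElem_map (x := .X 1)).mul evalJChi
      (isIntegralElem_evalJChi (isIntegralElem_isogenyV N)))
    refine (congrArg evalJChi.IsIntegralElem (funext fun x ↦ ?_)).mpr h
    have hq := quotNegTwo_mul_quotTwo x.1
    simp only [Pi.add_apply, Pi.mul_apply, evalJChi_apply]
    simp only [a, b, map_mul, map_sub,
      MvPolynomial.eval_C, MvPolynomial.eval_X, Matrix.cons_val_zero, Matrix.cons_val_one,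
      isogenyU, isogenyV, chiParam, ← hq]
    field_simp
    ring
  obtain ⟨p, hp, h⟩ := hW
  -- Substituting `aX` into the monic `p` leaves the leading coefficient `a ^ natDegree p`, which is
  -- nonzero.
  let q := p.comp (Polynomial.C a * Polynomial.X)
  refine ⟨(MvPolynomial.finSuccEquiv ℂ 2).symm q, ?_, fun τ s ↦ ?_⟩
  · rw [Ne, EmbeddingLike.map_eq_zero_iff]
    intro hq
    have := congrArg (fun r ↦ r.coeff p.natDegree) hq
    simp only [q, Polynomial.comp_C_mul_X_coeff, Polynomial.coeff_zero] at this
    rw [hp.coeff_natDegree, one_mul] at this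
    exact pow_ne_zero _ ha this
  · have h1 : relPoint N τ s = Fin.cons (chiParam (scale N τ) (s / N)) ![j τ, chiParam τ s] := rfl
    rw [h1, MvPolynomial.eval_eq_eval_mv_eval', AlgEquiv.apply_symm_apply]
    have h2 := congrFun h (τ, s)
    change Pi.evalRingHom (fun _ ↦ ℂ) (τ, s) _ = 0 at h2
    rw [Polynomial.hom_eval₂] at h2
    simp only [q, Polynomial.map_comp, Polynomial.eval_comp, Polynomial.map_mul,
      Polynomial.map_C, Polynomial.map_X, Polynomial.eval_mul, Polynomial.eval_C,
      Polynomial.eval_X]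
    rw [Polynomial.eval_map]
    exact h2

/-- For a fixed parameter `s`, polynomial expressions are holomorphic in `τ`. -/
lemma mdiff_eval_relPoint (N : ℕ) [NeZero N] (P : MvPolynomial (Fin 3) ℂ) (s : ℂ) :
    MDiff fun τ ↦ MvPolynomial.eval (relPoint N τ s) P := by
  have hchi (s : ℂ) : MDiff fun τ ↦ chiParam τ s :=
    (E2_mdifferentiable.sub mdifferentiable_const).mul mdiff_quotNegTwo
  induction P using MvPolynomial.induction_on with
  | C a => simpa using mdifferentiable_const
  | add p q hp hq => simpa using! hp.add hq
  | mul_X p i hp =>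
    simp only [map_mul, MvPolynomial.eval_X]
    refine hp.mul ?_
    fin_cases i
    · exact mdiff_comp_scale N (hchi _)
    · exact mdiff_j
    · exact hchi s

/-- For fixed `τ`, polynomial expressions are polynomial in `s`. -/
lemma exists_eval_relPoint (N : ℕ) [NeZero N] (P : MvPolynomial (Fin 3) ℂ) (τ : ℍ) :
    ∃ p : ℂ[X], ∀ s, MvPolynomial.eval (relPoint N τ s) P = p.eval s := by
  let c : Fin 3 → ℂ[X] :=
    ![(Polynomial.C (E2 (scale N τ)) - Polynomial.C (N : ℂ)⁻¹ * Polynomial.X) *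
        Polynomial.C (quotNegTwo (scale N τ)),
      Polynomial.C (j τ), (Polynomial.C (E2 τ) - Polynomial.X) * Polynomial.C (quotNegTwo τ)]
  refine ⟨MvPolynomial.eval₂ Polynomial.C c P, fun s ↦ ?_⟩
  rw [← Polynomial.coe_evalRingHom, MvPolynomial.hom_eval₂]
  have h1 : (Polynomial.evalRingHom s).comp Polynomial.C = RingHom.id ℂ := by ext; simp
  rw [h1]
  change MvPolynomial.eval₂ _ _ _ = _
  congr 1
  funext i
  fin_cases i <;> simp [relPoint, c, chiParam, div_eq_inv_mul]

/-- For fixed `τ` the value is a polynomial in `s` with infinitely many roots. -/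
lemma isRelation_of_infinite (N : ℕ) [NeZero N] {P : MvPolynomial (Fin 3) ℂ} {S : Set ℂ}
    (hS : S.Infinite) (h : ∀ s ∈ S, ∀ τ, MvPolynomial.eval (relPoint N τ s) P = 0) :
    IsRelation N P := by
  intro τ s
  obtain ⟨p, hp⟩ := exists_eval_relPoint N P τ
  have : p = 0 := Polynomial.eq_zero_of_infinite_isRoot p
    (hS.mono fun s hs ↦ by
      change p.eval s = 0
      rw [← hp, h s hs])
  rw [hp, this, Polynomial.eval_zero]

/-- For each `s` one factor vanishes identically in `τ`; one of the two does so for infinitely many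
`s`. -/
lemma IsRelation.of_mul (N : ℕ) [NeZero N] {P Q : MvPolynomial (Fin 3) ℂ}
    (h : IsRelation N (P * Q)) : IsRelation N P ∨ IsRelation N Q := by
  have hs (s : ℂ) : (∀ τ, MvPolynomial.eval (relPoint N τ s) P = 0) ∨
      ∀ τ, MvPolynomial.eval (relPoint N τ s) Q = 0 := by
    have := (UpperHalfPlane.mul_eq_zero_iff (mdiff_eval_relPoint N P s)
      (mdiff_eval_relPoint N Q s)).mp (funext fun τ ↦ by simpa using h τ s)
    exact this.imp congrFun congrFun
  have huniv : ({s | ∀ τ, MvPolynomial.eval (relPoint N τ s) P = 0} ∪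
      {s | ∀ τ, MvPolynomial.eval (relPoint N τ s) Q = 0}).Infinite := by
    convert Set.infinite_univ (α := ℂ)
    exact Set.eq_univ_of_forall hs
  rw [Set.infinite_union] at huniv
  exact huniv.imp (fun h ↦ isRelation_of_infinite N h fun s hs ↦ hs)
    fun h ↦ isRelation_of_infinite N h fun s hs ↦ hs

/-- A nonzero relation of minimal total degree is irreducible. -/
lemma irreducible_of_minimal (N : ℕ) [NeZero N] {P : MvPolynomial (Fin 3) ℂ} (hP : P ≠ 0)
    (hrel : IsRelation N P)
    (hmin : ∀ Q, Q ≠ 0 → IsRelation N Q → P.totalDegree ≤ Q.totalDegree) : Irreducible P := by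
  have hunit (A : MvPolynomial (Fin 3) ℂ) (hA : A ≠ 0) (h : A.totalDegree = 0) : IsUnit A := by
    rw [MvPolynomial.totalDegree_eq_zero_iff_eq_C] at h
    rw [h] at hA ⊢
    exact (isUnit_iff_ne_zero.mpr (by simpa using hA)).map MvPolynomial.C
  refine ⟨fun hu ↦ ?_, fun {A B} hAB ↦ ?_⟩
  · exact (hu.map (MvPolynomial.eval (relPoint N UpperHalfPlane.I 0))).ne_zero (hrel _ _)
  · subst hAB
    obtain ⟨hA, hB⟩ := mul_ne_zero_iff.mp hP
    -- Total degrees add, so if one factor is a relation, minimality forces the other to be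
    -- constant.
    have hdeg := MvPolynomial.totalDegree_mul_of_isDomain hA hB
    rcases hrel.of_mul N with h | h
    · right
      exact hunit B hB (by have := hmin A hA h; lia)
    · left
      exact hunit A hA (by have := hmin B hB h; lia)

end ModRel

end

/-! ### Rationality through `q`-series. -/

noncomputable section

open Complex Filter Asymptotics Function.Periodic
open scoped Manifold Topology Polynomial

namespace ModRel

/-- Functions on the upper half plane given by a power series in `q` with rational
coefficients. -/
def HasRatSeries (f : ℍ → ℂ) : Prop :=
  ∃ a : ℕ → ℚ, ∀ τ : ℍ, HasSum (fun n ↦ (a n : ℂ) * qParam 1 τ ^ n) (f τ)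

lemma hasSum_of_eq {f g : ℕ → ℂ} {x : ℂ} (h : HasSum f x) (hfg : ∀ n, f n = g n) : HasSum g x :=
  funext hfg ▸ h

lemma HasRatSeries.const (c : ℚ) : HasRatSeries fun _ ↦ c := by
  refine ⟨fun n ↦ if n = 0 then c else 0, fun τ ↦ ?_⟩
  convert hasSum_ite_eq 0 (c : ℂ) using 2 with n
  split_ifs with h <;> simp [h]

lemma HasRatSeries.add {f g : ℍ → ℂ} (hf : HasRatSeries f) (hg : HasRatSeries g) :
    HasRatSeries fun τ ↦ f τ + g τ := by
  obtain ⟨a, ha⟩ := hf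
  obtain ⟨b, hb⟩ := hg
  refine ⟨fun n ↦ a n + b n, fun τ ↦ ?_⟩
  convert (ha τ).add (hb τ) using 2 with n
  push_cast; ring

lemma HasRatSeries.mul {f g : ℍ → ℂ} (hf : HasRatSeries f) (hg : HasRatSeries g) :
    HasRatSeries fun τ ↦ f τ * g τ := by
  obtain ⟨a, ha⟩ := hf
  obtain ⟨b, hb⟩ := hg
  refine ⟨fun n ↦ ∑ kl ∈ Finset.HasAntidiagonal.antidiagonal n, a kl.1 * b kl.2, fun τ ↦ ?_⟩
  have h1 := (ha τ).summable.norm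
  have h2 := (hb τ).summable.norm
  have h3 := tsum_mul_tsum_eq_tsum_sum_antidiagonal_of_summable_norm h1 h2
  have h4 := (summable_norm_sum_mul_antidiagonal_of_summable_norm h1 h2).of_norm.hasSum
  rw [← h3, (ha τ).tsum_eq, (hb τ).tsum_eq] at h4
  refine hasSum_of_eq h4 fun n ↦ ?_
  rw [Rat.cast_sum, Finset.sum_mul]
  refine Finset.sum_congr rfl fun kl hkl ↦ ?_
  rw [← Finset.HasAntidiagonal.mem_antidiagonal.mp hkl, pow_add]
  push_cast; ring

lemma HasRatSeries.pow {f : ℍ → ℂ} (hf : HasRatSeries f) (n : ℕ) :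
    HasRatSeries fun τ ↦ f τ ^ n := by
  induction n with
  | zero => simpa using HasRatSeries.const 1
  | succ n ih => simpa only [pow_succ] using ih.mul hf

lemma HasRatSeries.sub {f g : ℍ → ℂ} (hf : HasRatSeries f) (hg : HasRatSeries g) :
    HasRatSeries fun τ ↦ f τ - g τ := by
  have := hf.add ((HasRatSeries.const (-1)).mul hg)
  simpa [← sub_eq_add_neg] using this

lemma HasRatSeries.prod {ι : Type*} (s : Finset ι) {f : ι → ℍ → ℂ}
    (hf : ∀ i ∈ s, HasRatSeries (f i)) : HasRatSeries fun τ ↦ ∏ i ∈ s, f i τ := by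
  classical
  induction s using Finset.induction_on with
  | empty => simpa using HasRatSeries.const 1
  | insert i s hi ih =>
    simp only [Finset.prod_insert hi]
    exact (hf i (by simp)).mul (ih fun k hk ↦ hf k (by simp [hk]))

lemma HasRatSeries.comp_scale (N : ℕ) [NeZero N] {f : ℍ → ℂ} (hf : HasRatSeries f) :
    HasRatSeries fun τ ↦ f (scale N τ) := by
  obtain ⟨a, ha⟩ := hf
  refine ⟨fun n ↦ if N ∣ n then a (n / N) else 0, fun τ ↦ ?_⟩
  have hinj : Function.Injective fun n : ℕ ↦ N * n := mul_right_injective₀ (NeZero.ne N)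
  rw [← hinj.hasSum_iff]
  · refine hasSum_of_eq (ha (scale N τ)) fun n ↦ ?_
    have hq : qParam 1 (scale N τ) = qParam 1 τ ^ N := by
      rw [qParam, qParam, ← Complex.exp_nat_mul, coe_scale]
      congr 1
      ring
    simp [Nat.mul_div_cancel_left n (NeZero.pos N), hq, pow_mul]
  · intro n hn
    have : ¬ N ∣ n := fun ⟨k, hk⟩ ↦ hn ⟨k, hk.symm⟩
    simp [this]

lemma hasRatSeries_E2 : HasRatSeries E2 := by
  refine ⟨fun m ↦ if m = 0 then 1 else -24 * (ArithmeticFunction.sigma 1 m : ℕ), fun τ ↦ ?_⟩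
  refine hasSum_of_eq (hasSum_qExpansion_E2 (z := τ)) fun n ↦ ?_
  have hq : qParam 1 (τ : ℂ) = Complex.exp (2 * Real.pi * Complex.I * τ) := by
    simp [qParam]
  rw [hq]
  split_ifs with h0 <;> simp [h0]

lemma hasRatSeries_E {k : ℕ} (hk : 3 ≤ k) (hk2 : Even k) :
    HasRatSeries fun τ ↦ ModularForm.E hk τ := by
  refine ⟨fun m ↦ if m = 0 then 1 else
    -(2 * k / bernoulli k) * (ArithmeticFunction.sigma (k - 1) m : ℕ), fun τ ↦ ?_⟩
  have h := hasSum_qExpansion one_pos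
    (SlashInvariantFormClass.periodic_comp_ofComplex (E hk) one_mem_strictPeriods_SL) (E hk).holo'
    (ModularFormClass.bdd_at_infty (E hk)) τ
  refine hasSum_of_eq h fun n ↦ ?_
  rw [E_qExpansion_coeff hk hk2]
  split_ifs with h0 <;> simp [h0]

lemma hasRatSeries_Delta : HasRatSeries Delta := by
  have h := (((hasRatSeries_E (by norm_num : 3 ≤ 4) ⟨2, rfl⟩).pow 3).sub
    ((hasRatSeries_E (by norm_num : 3 ≤ 6) ⟨3, rfl⟩).pow 2)).mul (HasRatSeries.const (1 / 1728))
  convert h using 2 with τ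
  simp [Delta, div_eq_mul_inv]

/-- The series represents the cusp function of `0`, and power series coefficients are unique. -/
lemma eq_zero_of_hasSum_zero {c : ℕ → ℂ}
    (h : ∀ τ : ℍ, HasSum (fun n ↦ c n * qParam 1 τ ^ n) 0) : c = 0 := by
  have h0 : UpperHalfPlane.cuspFunction 1 (0 : ℍ → ℂ) = 0 := by
    ext q
    rcases eq_or_ne q 0 with rfl | hq
    · exact IsZeroAtImInfty.cuspFunction_apply_zero tendsto_const_nhds one_pos
    · simp [UpperHalfPlane.cuspFunction, Function.Periodic.cuspFunction, hq]
  have := hasFPowerSeriesOnBall_cuspFunction (f := 0) one_pos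
    (by rw [h0]; exact analyticAt_const) h
  rw [h0] at this
  have := this.hasFPowerSeriesAt.eq_zero
  ext n
  rw [← FormalMultilinearSeries.coeff_ofScalars (𝕜 := ℂ) (p := c) (n := n), this]
  rfl

/-- A `ℂ`-linear relation between functions with rational `q`-series yields `ℚ`-linear ones. -/
lemma sum_eq_zero_of_hasRatSeries {ι : Type*} (s : Finset ι) {F : ι → ℍ → ℂ}
    (hF : ∀ i ∈ s, HasRatSeries (F i)) {c : ι → ℂ} (h : ∀ τ, ∑ i ∈ s, c i * F i τ = 0)
    (φ : ℂ →ₗ[ℚ] ℚ) (τ : ℍ) : ∑ i ∈ s, (φ (c i) : ℂ) * F i τ = 0 := by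
  classical
  choose! a ha using hF
  have hc : (fun n ↦ ∑ i ∈ s, c i * a i n) = 0 := by
    refine eq_zero_of_hasSum_zero fun τ ↦ ?_
    rw [← h τ]
    refine hasSum_of_eq (hasSum_sum fun i hi ↦ (ha i hi τ).mul_left (c i)) fun n ↦ ?_
    rw [Finset.sum_mul]
    exact Finset.sum_congr rfl fun i _ ↦ by ring
  -- The `a i n` are rational, so `φ` passes through them.
  have hφ (n : ℕ) : ∑ i ∈ s, φ (c i) * a i n = 0 := by
    have := congrArg φ (congrFun hc n)
    rw [Pi.zero_apply, map_zero, map_sum] at this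
    rw [← this]
    refine Finset.sum_congr rfl fun i _ ↦ ?_
    rw [mul_comm (c i), ← Rat.smul_def, map_smul, smul_eq_mul, mul_comm]
  have h1 : HasSum (fun n ↦ ∑ i ∈ s, (φ (c i) : ℂ) * ((a i n : ℂ) * qParam 1 τ ^ n))
      (∑ i ∈ s, (φ (c i) : ℂ) * F i τ) :=
    hasSum_sum fun i hi ↦ (ha i hi τ).mul_left (φ (c i) : ℂ)
  refine h1.unique (hasSum_of_eq hasSum_zero fun n ↦ ?_)
  have := congrArg (fun x : ℚ ↦ (x : ℂ) * qParam 1 τ ^ n) (hφ n)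
  simp only [Rat.cast_zero, zero_mul] at this
  rw [← this]
  push_cast
  rw [Finset.sum_mul]
  exact Finset.sum_congr rfl fun i _ ↦ by ring

/-- `HasRatSeries` allows no pole at the cusp; a high power of `D` clears the poles of all monomials
at once. -/
lemma hasRatSeries_pow_mul_pow {x D : ℍ → ℂ} (hD : HasRatSeries D)
    (hx : HasRatSeries fun τ ↦ x τ * D τ) {m d : ℕ} (h : m ≤ d) :
    HasRatSeries fun τ ↦ x τ ^ m * D τ ^ d := by
  obtain ⟨e, rfl⟩ := Nat.exists_eq_add_of_le h
  convert (hx.pow m).mul (hD.pow e) using 2 with τ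
  rw [mul_pow, pow_add, mul_assoc]

lemma hasRatSeries_j_mul_Delta : HasRatSeries fun τ ↦ j τ * Delta τ := by
  convert (hasRatSeries_E (by norm_num : 3 ≤ 4) ⟨2, rfl⟩).pow 3 using 2 with τ
  rw [j_eq, div_mul_cancel₀ _ (Delta_ne_zero τ)]

lemma hasRatSeries_chiParam_mul_Delta (s : ℚ) :
    HasRatSeries fun τ ↦ chiParam τ s * Delta τ := by
  convert (hasRatSeries_E2.sub (HasRatSeries.const s)).mul
    ((hasRatSeries_E (by norm_num : 3 ≤ 4) ⟨2, rfl⟩).mul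
      (hasRatSeries_E (by norm_num : 3 ≤ 6) ⟨3, rfl⟩)) using 2 with τ
  rw [chiParam, quotNegTwo, mul_assoc, div_mul_cancel₀ _ (Delta_ne_zero τ)]

/-- Apply a `ℚ`-linear functional to the coefficients of a polynomial. -/
def mapCoeffs (φ : ℂ →ₗ[ℚ] ℚ) (P : MvPolynomial (Fin 3) ℂ) : MvPolynomial (Fin 3) ℚ :=
  ∑ m ∈ P.support, MvPolynomial.monomial m (φ (P.coeff m))

lemma coeff_mapCoeffs (φ : ℂ →ₗ[ℚ] ℚ) (P : MvPolynomial (Fin 3) ℂ) (m : Fin 3 →₀ ℕ) :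
    (mapCoeffs φ P).coeff m = φ (P.coeff m) := by
  classical
  rw [mapCoeffs, MvPolynomial.coeff_sum]
  simp only [MvPolynomial.coeff_monomial]
  rw [Finset.sum_ite_eq']
  split_ifs with h
  · rfl
  · rw [MvPolynomial.notMem_support_iff.mp h, map_zero]

lemma totalDegree_mapCoeffs_le (φ : ℂ →ₗ[ℚ] ℚ) (P : MvPolynomial (Fin 3) ℂ) :
    (MvPolynomial.map (algebraMap ℚ ℂ) (mapCoeffs φ P)).totalDegree ≤ P.totalDegree := by
  refine Finset.sup_mono fun m hm ↦ ?_
  rw [MvPolynomial.mem_support_iff, MvPolynomial.coeff_map, coeff_mapCoeffs] at hm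
  rw [MvPolynomial.mem_support_iff]
  intro h
  simp [h] at hm

/-- Rational `s` suffice, being infinitely many; for them each monomial times a common product of
powers of `Δ` has a rational `q`-series. -/
lemma isRelation_mapCoeffs (N : ℕ) [NeZero N] {P : MvPolynomial (Fin 3) ℂ}
    (hP : IsRelation N P) (φ : ℂ →ₗ[ℚ] ℚ) :
    IsRelation N (MvPolynomial.map (algebraMap ℚ ℂ) (mapCoeffs φ P)) := by
  refine isRelation_of_infinite N (S := Set.range ((↑) : ℚ → ℂ))
    (Set.infinite_range_of_injective Rat.cast_injective) ?_
  rintro _ ⟨s, rfl⟩ τ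
  set d := ∑ m ∈ P.support, ∑ i, m i with hd
  have hle (m) (hm : m ∈ P.support) (i : Fin 3) : m i ≤ d :=
    (Finset.single_le_sum (f := fun i ↦ m i) (fun _ _ ↦ Nat.zero_le _) (Finset.mem_univ i)).trans
      (Finset.single_le_sum (f := fun m : Fin 3 →₀ ℕ ↦ ∑ i, m i) (fun _ _ ↦ Nat.zero_le _) hm)
  let D : Fin 3 → ℍ → ℂ := ![fun τ ↦ Delta (scale N τ), Delta, Delta]
  have hD (i) : HasRatSeries (D i) := by
    fin_cases i
    · exact hasRatSeries_Delta.comp_scale N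
    · exact hasRatSeries_Delta
    · exact hasRatSeries_Delta
  have hx (i) : HasRatSeries fun τ ↦ relPoint N τ s i * D i τ := by
    fin_cases i
    · have := (hasRatSeries_chiParam_mul_Delta (s / N)).comp_scale N
      push_cast at this
      exact this
    · exact hasRatSeries_j_mul_Delta
    · exact hasRatSeries_chiParam_mul_Delta s
  have hF (m) (hm : m ∈ P.support) :
      HasRatSeries fun τ ↦ ∏ i, relPoint N τ s i ^ m i * D i τ ^ d :=
    HasRatSeries.prod _ fun i _ ↦ hasRatSeries_pow_mul_pow (hD i) (hx i) (hle m hm i)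
  have h0 (τ : ℍ) : ∑ m ∈ P.support, P.coeff m * ∏ i, (relPoint N τ s i ^ m i * D i τ ^ d) = 0 := by
    have h := hP τ s
    rw [MvPolynomial.eval_eq'] at h
    simp only [Finset.prod_mul_distrib, ← mul_assoc]
    rw [← Finset.sum_mul, h, zero_mul]
  have h1 := sum_eq_zero_of_hasRatSeries P.support hF h0 φ τ
  simp only [Finset.prod_mul_distrib, ← mul_assoc] at h1
  rw [← Finset.sum_mul] at h1
  have hne : ∏ i, D i τ ^ d ≠ 0 := by
    refine Finset.prod_ne_zero_iff.mpr fun i _ ↦ pow_ne_zero _ ?_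
    fin_cases i <;> exact Delta_ne_zero _
  rw [mapCoeffs, map_sum, map_sum]
  refine Eq.trans (Finset.sum_congr rfl fun m _ ↦ ?_) ((mul_eq_zero.mp h1).resolve_right hne)
  rw [MvPolynomial.map_monomial, MvPolynomial.eval_monomial, Finsupp.prod_fintype _ _ (by simp)]
  rfl

/-- There is a rational relation which is irreducible over `ℂ`. -/
lemma exists_irreducible_relation (N : ℕ) [NeZero N] : ∃ Ψ : MvPolynomial (Fin 3) ℚ, Ψ ≠ 0 ∧
    Irreducible (MvPolynomial.map (algebraMap ℚ ℂ) Ψ) ∧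
    IsRelation N (MvPolynomial.map (algebraMap ℚ ℂ) Ψ) := by
  classical
  have hex : ∃ d, ∃ P, P ≠ 0 ∧ IsRelation N P ∧ P.totalDegree = d := by
    obtain ⟨P, h1, h2⟩ := exists_isRelation N
    exact ⟨_, P, h1, h2, rfl⟩
  obtain ⟨P, hP0, hP, hdeg⟩ := Nat.find_spec hex
  have hmin (Q) (hQ0 : Q ≠ 0) (hQ : IsRelation N Q) : P.totalDegree ≤ Q.totalDegree :=
    hdeg.trans_le (Nat.find_min' hex ⟨Q, hQ0, hQ, rfl⟩)
  obtain ⟨m, hm⟩ := MvPolynomial.ne_zero_iff.mp hP0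
  -- Some functional is nonzero on a nonzero coefficient, so the rational relation is nonzero.
  obtain ⟨φ, hφ⟩ : ∃ φ : ℂ →ₗ[ℚ] ℚ, φ (P.coeff m) ≠ 0 := by
    by_contra! h
    exact hm ((Module.forall_dual_apply_eq_zero_iff ℚ _).mp h)
  have h0 : mapCoeffs φ P ≠ 0 := fun h ↦ hφ (by rw [← coeff_mapCoeffs, h, MvPolynomial.coeff_zero])
  have h0' : MvPolynomial.map (algebraMap ℚ ℂ) (mapCoeffs φ P) ≠ 0 := by
    rwa [Ne, map_eq_zero_iff _ (MvPolynomial.map_injective _ (algebraMap ℚ ℂ).injective)]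
  have hrel := isRelation_mapCoeffs N hP φ
  exact ⟨_, h0, irreducible_of_minimal N h0' hrel fun Q hQ0 hQ ↦
    (totalDegree_mapCoeffs_le φ P).trans (hmin Q hQ0 hQ), hrel⟩

end ModRel

end

/-! ### Primitive matrices of determinant `N`. -/

namespace ModRel

/-- A primitive pair of rows with nonzero determinant has a primitive vector in the coset of
the second row modulo the first. -/
lemma exists_isCoprime_add_mul {a b c d n : ℤ} (hdet : a * d - b * c = n) (hn : n ≠ 0)
    (hprim : ∀ p : ℤ, Prime p → ¬ (p ∣ a ∧ p ∣ b ∧ p ∣ c ∧ p ∣ d)) :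
    ∃ t : ℤ, IsCoprime (c + t * a) (d + t * b) := by
  classical
  -- A prime dividing the new row divides `n`. If it divides both `c` and `d`, it does not divide
  -- `t`, so it divides `a` and `b`, against primitivity. Otherwise it divides `t`, hence `c` and
  -- `d`, a contradiction.
  let S := n.natAbs.primeFactors.filter fun p : ℕ ↦ ¬ ((p : ℤ) ∣ c ∧ (p : ℤ) ∣ d)
  let t : ℤ := ∏ p ∈ S, (p : ℤ)
  refine ⟨t, isCoprime_of_prime_dvd (fun h ↦ ?_) fun p hp h1 h2 ↦ ?_⟩
  · apply hn
    linear_combination a * h.2 - b * h.1 - hdet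
  have hpn : p ∣ n := by
    have : n = a * (d + t * b) - b * (c + t * a) := by rw [← hdet]; ring
    rw [this]
    exact dvd_sub (h2.mul_left _) (h1.mul_left _)
  by_cases hcd : p ∣ c ∧ p ∣ d
  · have hta : p ∣ t * a := (dvd_add_right hcd.1).mp h1
    have htb : p ∣ t * b := (dvd_add_right hcd.2).mp h2
    have hpt : ¬ p ∣ t := by
      intro h
      obtain ⟨q, hq, hpq⟩ := (hp.dvd_finsetProd_iff _).mp h
      obtain ⟨hq1, hq2⟩ := Finset.mem_filter.mp hq
      have hqp : Prime (q : ℤ) := Nat.prime_iff_prime_int.mp (Nat.prime_of_mem_primeFactors hq1)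
      have := (hp.dvd_prime_iff_associated hqp).mp hpq
      exact hq2 ⟨this.symm.dvd.trans hcd.1, this.symm.dvd.trans hcd.2⟩
    exact hprim p hp ⟨(hp.dvd_or_dvd hta).resolve_left hpt, (hp.dvd_or_dvd htb).resolve_left hpt,
      hcd.1, hcd.2⟩
  · have hpt : p ∣ t := by
      have hmem : p.natAbs ∈ S := by
        refine Finset.mem_filter.mpr ⟨?_, by simpa [Int.natAbs_dvd] using hcd⟩
        exact Nat.mem_primeFactors.mpr ⟨Int.prime_iff_natAbs_prime.mp hp,
          Int.natAbs_dvd_natAbs.mpr hpn, by simpa using hn⟩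
      exact (Int.dvd_natAbs.mpr dvd_rfl).trans (Finset.dvd_prod_of_mem (fun q : ℕ ↦ (q : ℤ)) hmem)
    exact hcd ⟨(dvd_add_left (hpt.mul_right a)).mp h1, (dvd_add_left (hpt.mul_right b)).mp h2⟩

/-- Every primitive matrix of determinant `N` acts like `γ ∘ (τ ↦ N τ) ∘ γ'` with `γ, γ'`
in `SL(2, ℤ)`. -/
lemma exists_moebius_eq (N : ℕ) [NeZero N] {g : GL(2, ℚ)⁺} (hg : g ∈ primitiveMatrices N) :
    ∃ γ γ' : SL(2, ℤ), ∀ τ, moebius g τ = γ • scale N (γ' • τ) := by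
  obtain ⟨A, hA, hdet, hprim⟩ := hg
  rw [Matrix.det_fin_two] at hdet
  set a := A 0 0 with ha
  set b := A 0 1 with hb
  set c := A 1 0 with hc
  set d := A 1 1 with hd
  obtain ⟨t, x, y, hxy⟩ := exists_isCoprime_add_mul hdet (by exact_mod_cast NeZero.ne N)
    fun p hp h ↦ hp.not_isUnit (hprim p fun i k ↦ by
      fin_cases i <;> fin_cases k
      exacts [h.1, h.2.1, h.2.2.1, h.2.2.2])
  -- Complete the primitive row to `γ'`. Then `(1, 0; t, 1) A = (N, k; 0, 1) γ' = (1, k; 0, 1)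
  -- diag(N, 1) γ'`, so `γ = (1, 0; -t, 1)(1, k; 0, 1)`.
  obtain ⟨γ', hγ'⟩ := exists_SL_of_det (show y * (d + t * b) - (-x) * (c + t * a) = 1 by
    linear_combination hxy)
  set k := a * x + b * y with hk
  obtain ⟨γ, hγ⟩ := exists_SL_of_det (show (1 : ℤ) * (1 - t * k) - k * (-t) = 1 by ring)
  refine ⟨γ, γ', fun τ ↦ UpperHalfPlane.ext ?_⟩
  obtain ⟨h1, h2⟩ := hγ' τ
  obtain ⟨h3, h4⟩ := hγ (scale N (γ' • τ))
  have hne1 := denom_ne_zero γ' τ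
  have hne2 := denom_ne_zero γ (scale N (γ' • τ))
  rw [h2] at hne1
  rw [h4, coe_scale, h1] at hne2
  rw [h3, coe_scale, h1, coe_moebius]
  have e00 : ((g : GL (Fin 2) ℚ) 0 0 : ℂ) = a := by rw [hA]; simp [ha]
  have e01 : ((g : GL (Fin 2) ℚ) 0 1 : ℂ) = b := by rw [hA]; simp [hb]
  have e10 : ((g : GL (Fin 2) ℚ) 1 0 : ℂ) = c := by rw [hA]; simp [hc]
  have e11 : ((g : GL (Fin 2) ℚ) 1 1 : ℂ) = d := by rw [hA]; simp [hd]
  rw [e00, e01, e10, e11]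
  have hxy' : (x : ℂ) * (c + t * a) + y * (d + t * b) = 1 := by exact_mod_cast hxy
  have hdet' : (a : ℂ) * d - b * c = N := by exact_mod_cast hdet
  set D : ℂ := ((c + t * a : ℤ) : ℂ) * τ + ((d + t * b : ℤ) : ℂ) with hD
  have hnum : ((1 : ℤ) : ℂ) * (N * ((((y : ℤ) : ℂ) * τ + ((-x : ℤ) : ℂ)) / D)) + ((k : ℤ) : ℂ) =
      (a * τ + b) / D := by
    field_simp
    rw [hD, hk, ← hdet']
    push_cast
    linear_combination ((a : ℂ) * τ + b) * hxy'
  have hden : ((-t : ℤ) : ℂ) * (N * ((((y : ℤ) : ℂ) * τ + ((-x : ℤ) : ℂ)) / D)) +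
      ((1 - t * k : ℤ) : ℂ) = (c * τ + d) / D := by
    have : ((-t : ℤ) : ℂ) * (N * ((((y : ℤ) : ℂ) * τ + ((-x : ℤ) : ℂ)) / D)) +
      ((1 - t * k : ℤ) : ℂ) = 1 - t * ((a * τ + b) / D) := by
      rw [← hnum]; push_cast; ring
    rw [this]
    field_simp
    rw [hD]
    push_cast
    ring
  rw [hnum, hden, div_div_div_cancel_right₀ hne1]

end ModRel

theorem mainTheorem6 (N : ℕ) (hN : 0 < N) :
    ∃ Ψ : MvPolynomial (Fin 3) ℚ,
      Ψ ≠ 0 ∧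
      Irreducible (MvPolynomial.map (algebraMap ℚ ℂ) Ψ) ∧
      ∀ g ∈ ModRel.primitiveMatrices N, ∀ τ : UpperHalfPlane,
        MvPolynomial.aeval
          ![ModRel.chiStar (ModRel.moebius g τ), ModRel.j τ, ModRel.chiStar τ] Ψ = 0 := by
  have : NeZero N := ⟨hN.ne'⟩
  obtain ⟨Ψ, h0, hirr, hrel⟩ := ModRel.exists_irreducible_relation N
  refine ⟨Ψ, h0, hirr, fun g hg τ ↦ ?_⟩
  obtain ⟨γ, γ', h⟩ := ModRel.exists_moebius_eq N hg
  -- By invariance `τ` is replaced by `γ'τ` throughout, giving `relPoint` at `γ'τ` with `s = 3 / (π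
  -- Im γ'τ)`.
  rw [h τ, ModRel.chiStar_smul, ← ModRel.j_smul γ' τ, ← ModRel.chiStar_smul γ' τ,
    ← ModRel.relPoint_eq, MvPolynomial.aeval_def, ← MvPolynomial.eval_map]
  exact hrel _ _
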